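/- **Theorem 4.1.** Let $d \ge 1$ be an integer and let $G = ([d],E)$ be a (simple) graph with vertex set $[d] = \{1,\dots,d\}$. For $n \ge 0$ let $$\chi^{\mathbb 1}_G(q,n) := \sum_{\substack{c:[d]\to[n] \\ c \text{ a proper coloring of } G}} q^{\sum_{v\in[d]} c(v)} \in \mathbb{Z}[q]$$ be the $q$-chromatic polynomial of $G$ with respect to the linear form $\mathbb 1 = (1,\dots,1)$. For a permutation $\pi=[\pi(1)\cdots\pi(d)]\in S_d$, let the rank $\mathrm{rk}_\pi(\pi(i))$ be the largest $r\ge 1$ for which there are positions $i_1<i_2<\cdots<i_r=i$ with $\{\pi(i_j),\pi(i_{j+1})\}\in E$ for $1\le j<r$, and let $\mathrm{Asc}_G(\pi)\subseteq\{1,\dots,d-1\}$ be the set of $G$-ascents of $\pi$, that is, of all $i\in\{1,\dots,d-1\}$ such that either $\mathrm{rk}_\pi(\pi(i))<\mathrm{rk}_\pi(\pi(i+1))$, or $\mathrm{rk}_\pi(\pi(i))=\mathrm{rk}_\pi(\pi(i+1))$ and $\pi(i)<\pi(i+1)$. Let $\mathrm{asc}_G(\pi) := |\mathrm{Asc}_G(\pi)|$.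 Then, as formal power series in $z$ with coefficients in $\mathbb{Z}[q]$, $$\sum_{n\ge 0}\chi^{\mathbb 1}_G(q,n)\,z^n \;=\; \frac{\displaystyle\sum_{\pi\in S_d} q^{\,d+\sum_{j\in \mathrm{Asc}_G(\pi)}(d-j)}\; z^{\,\mathrm{asc}_G(\pi)+1}}{(1-z)(1-qz)(1-q^2z)\cdots(1-q^dz)}.$$ -/

import Mathlib

open scoped Polynomial PowerSeries

namespace QChromatic

noncomputable section

/-- The `q`-chromatic polynomial of `G` with respect to the linear form `lam`, evaluated at `n`:
the sum of `q ^ (∑ v, lam v * c v)` over all proper colorings `c` of `G` with colors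
`{1, ..., n}`, as a polynomial in `q = Polynomial.X`. The colors are `Fin n = {0, ..., n - 1}`,
so the color `k : Fin n` counts as `k + 1`. -/
def qChromatic {V : Type*} [Fintype V] (G : SimpleGraph V) (lam : V → ℕ) (n : ℕ) : ℤ[X] :=
  ∑ c : G.Coloring (Fin n), Polynomial.X ^ (∑ v, lam v * ((c v : ℕ) + 1))

variable {d : ℕ}

/-- There are positions `i₁ < i₂ < ... < iᵣ` with `r = k + 1 ≥ 1`, such that `π iᵣ = v` and
consecutive entries `π iⱼ`, `π iⱼ₊₁` are adjacent in `G`. -/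
def HasPathOfLength (G : SimpleGraph (Fin d)) (π : Equiv.Perm (Fin d)) (v : Fin d) (r : ℕ) : Prop :=
  ∃ k : ℕ, r = k + 1 ∧ ∃ p : Fin (k + 1) → Fin d, StrictMono p ∧ π (p (Fin.last k)) = v ∧
    ∀ j : Fin k, G.Adj (π (p j.castSucc)) (π (p j.succ))

/-- The rank of the vertex `v` with respect to the permutation `π`: the largest `r` as in
`HasPathOfLength` (see `isGreatest_rank`). -/
def rank (G : SimpleGraph (Fin d)) (π : Equiv.Perm (Fin d)) (v : Fin d) : ℕ :=
  sSup {r : ℕ | HasPathOfLength G π v r}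

/-- The largest `r` in the definition of the rank exists. -/
theorem isGreatest_rank (G : SimpleGraph (Fin d)) (π : Equiv.Perm (Fin d)) (v : Fin d) :
    IsGreatest {r : ℕ | HasPathOfLength G π v r} (rank G π v) := by
  have hne : {r : ℕ | HasPathOfLength G π v r}.Nonempty :=
    ⟨1, 0, rfl, fun _ => π.symm v,
      fun a b h => absurd h (by omega), by simp, fun j => j.elim0⟩
  have hb : BddAbove {r : ℕ | HasPathOfLength G π v r} := by
    refine ⟨d, ?_⟩
    rintro r ⟨k, rfl, p, hp, -, -⟩
    simpa using Fintype.card_le_of_injective p hp.injective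
  exact ⟨Nat.sSup_mem hne hb, fun r hr => le_csSup hb hr⟩

/-- `π` has a `G`-ascent at the position `j` (positions being counted from `1`): the `j`-th and
`(j + 1)`-st entries of `π` have strictly increasing ranks, or equal ranks and increasing labels.
The `j`-th position is the element of `Fin d` with value `j - 1`. -/
def IsAscentAt (G : SimpleGraph (Fin d)) (π : Equiv.Perm (Fin d)) (j : ℕ) : Prop :=
  ∃ a b : Fin d, (a : ℕ) + 1 = j ∧ (b : ℕ) = j ∧
    (rank G π (π a) < rank G π (π b) ∨ (rank G π (π a) = rank G π (π b) ∧ π a < π b))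

open Classical in
/-- The set of `G`-ascents of `π`, a subset of `{1, ..., d - 1}`. -/
def ascents (G : SimpleGraph (Fin d)) (π : Equiv.Perm (Fin d)) : Finset ℕ :=
  {j ∈ Finset.Icc 1 (d - 1) | IsAscentAt G π j}

/-- The generating function `∑ₙ χ_G^lam(q, n) zⁿ`, a formal power series in `z` over `ℤ[q]`. -/
def qChromaticSeries {V : Type*} [Fintype V] (G : SimpleGraph V) (lam : V → ℕ) : ℤ[X]⟦X⟧ :=
  PowerSeries.mk (fun n => qChromatic G lam n)

/-- The numerator `∑_π q ^ (d + ∑_{j ∈ asc_G(π)} (d - j)) z ^ (|asc_G(π)| + 1)`. -/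
def numerator (G : SimpleGraph (Fin d)) : ℤ[X]⟦X⟧ :=
  ∑ π : Equiv.Perm (Fin d),
    PowerSeries.C ((Polynomial.X : ℤ[X]) ^ (d + ∑ j ∈ ascents G π, (d - j))) *
      PowerSeries.X ^ ((ascents G π).card + 1)

/-- The denominator `(1 - z) (1 - q z) ⋯ (1 - q ^ d z)`. -/
def denominator (d : ℕ) : ℤ[X]⟦X⟧ :=
  ∏ k ∈ Finset.range (d + 1),
    (1 - PowerSeries.C ((Polynomial.X : ℤ[X]) ^ k) * PowerSeries.X)

end

end QChromatic

/-!
Every proper coloring `c` of `G` orients the edges of `G` from the smaller to the larger color. A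
permutation `π` along which `c` weakly increases induces the same orientation, so `rank G π v` is
the length of the longest path ending at `v` whose colors strictly increase, whichever such `π` is
used (`rank_eq_of_monotone`). Sort the vertices by color, ties by decreasing rank, further ties by
decreasing label. This gives the only permutation `π` for which `c ∘ π` weakly increases, and
strictly so at the `G`-ascents of `π` (`existsUnique_isCompatible`). Conversely, if such a `π`
exists then `c` is proper, since the rank increases along each edge of the orientation, which
forces an ascent, hence a change of color, between its two ends (`ne_of_isCompatible`).

So the colorings are counted by the weakly increasing sequences of length `d` which are strict at
the ascents of `π`, summed over `π` (`qChromatic_eq_sum`). The generating function of these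
sequences is found by induction on the length: a sequence either has all its entries positive and
can be lowered by `1`, or starts with `0`, which can be removed
(`compatibleSum_succ_succ`, `compatibleSeries_mul_denominator`).
-/

namespace QChromatic

/-! ### Weakly increasing sequences with prescribed strict steps -/

/-- The sequence `f` weakly increases, and strictly increases at the places in `S`. As in
`IsAscentAt`, the place `j` is the step from the `j`-th to the `(j + 1)`-st entry, counted
from `1`. -/
def IsCompatible {d : ℕ} {α : Type*} [Preorder α] (S : ℕ → Prop) (f : Fin d → α) : Prop :=
  ∀ i j : Fin d, (i : ℕ) + 1 = j → f i ≤ f j ∧ (S j → f i < f j)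

theorem IsCompatible.monotone {d : ℕ} {α : Type*} [Preorder α] {S : ℕ → Prop} {f : Fin d → α}
    (h : IsCompatible S f) : Monotone f := by
  cases d with
  | zero => exact fun a => a.elim0
  | succ d => exact Fin.monotone_iff_le_succ.2 fun i => (h i.castSucc i.succ (by simp)).1

theorem isCompatible_strictMono_comp {d : ℕ} {α β : Type*} [LinearOrder α] [Preorder β]
    {S : ℕ → Prop} {f : Fin d → α} {g : α → β} (hg : StrictMono g) :
    IsCompatible S (g ∘ f) ↔ IsCompatible S f := by
  simp [IsCompatible, hg.le_iff_le, hg.lt_iff_lt]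

theorem isCompatible_cons {d : ℕ} {α : Type*} [Preorder α] {S : ℕ → Prop} {a : α}
    {f : Fin d → α} :
    IsCompatible S (Fin.cons a f : Fin (d + 1) → α) ↔
      (∀ h : 0 < d, a ≤ f ⟨0, h⟩ ∧ (S 1 → a < f ⟨0, h⟩)) ∧
        IsCompatible (fun j => S (j + 1)) f := by
  constructor
  · intro h
    refine ⟨fun hd => h 0 (Fin.succ ⟨0, hd⟩) rfl, fun i j hij => ?_⟩
    have := h i.succ j.succ (by simp [hij])
    simpa using this
  · rintro ⟨h0, h⟩ i j hij
    obtain ⟨j, rfl⟩ := Fin.exists_succ_eq.2 (show j ≠ 0 by rintro rfl; simp at hij)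
    induction i using Fin.cases with
    | zero =>
      have hj : j = ⟨0, j.pos⟩ := by ext; simpa using hij.symm
      have := h0 j.pos
      rw [← hj] at this
      have hj' : (j : ℕ) = 0 := by rw [hj]
      simpa [hj'] using this
    | succ i =>
      have := h i j (by simpa using hij)
      simpa using this

open Classical in
/-- The sum of `q ^ (∑ i, f i)` over all `S`-compatible sequences `f` of length `d` with entries
in `{0, ..., n - 1}`. -/
noncomputable def compatibleSum (d : ℕ) (S : ℕ → Prop) (n : ℕ) : ℤ[X] :=
  ∑ f : Fin d → Fin n, if IsCompatible S f then Polynomial.X ^ (∑ i, (f i : ℕ)) else 0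

theorem compatibleSum_succ_zero (d : ℕ) (S : ℕ → Prop) : compatibleSum (d + 1) S 0 = 0 := by
  simp [compatibleSum]

open Classical in
/-- Compatible sequences with positive entries only are the compatible sequences with the upper
bound lowered by `1`. -/
theorem sum_compatible_of_pos (d : ℕ) (S : ℕ → Prop) (n : ℕ) :
    (∑ f : Fin d → Fin (n + 1), if IsCompatible S f ∧ ∀ i, f i ≠ 0 then
      (Polynomial.X : ℤ[X]) ^ (∑ i, (f i : ℕ)) else 0) =
      Polynomial.X ^ d * compatibleSum d S n := by
  rw [compatibleSum, Finset.mul_sum]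
  symm
  refine Fintype.sum_of_injective (fun g => Fin.succ ∘ g)
    (fun g g' h => (Fin.succ_injective n).comp_left h) _ _ (fun f hf => ?_) (fun g => ?_)
  · refine if_neg fun h => hf ?_
    choose g hg using fun i => Fin.exists_succ_eq.2 (h.2 i)
    exact ⟨g, funext hg⟩
  · have hs : ∑ i, ((Fin.succ ∘ g) i : ℕ) = d + ∑ i, (g i : ℕ) := by
      simp [Finset.sum_add_distrib, add_comm]
    rw [isCompatible_strictMono_comp (Fin.strictMono_succ), hs, pow_add]
    simp

open Classical in
/-- A compatible sequence has only positive entries, or it starts with `0`. The remaining entries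
are positive exactly when the first step exists and is strict. -/
theorem compatibleSum_succ_succ (d : ℕ) (S : ℕ → Prop) (n : ℕ) :
    compatibleSum (d + 1) S (n + 1) =
      Polynomial.X ^ (d + 1) * compatibleSum (d + 1) S n +
        if 0 < d ∧ S 1 then Polynomial.X ^ d * compatibleSum d (fun j => S (j + 1)) n
        else compatibleSum d (fun j => S (j + 1)) (n + 1) := by
  have hzero : (∑ f : Fin (d + 1) → Fin (n + 1), if IsCompatible S f ∧ f 0 = 0 then
      (Polynomial.X : ℤ[X]) ^ (∑ i, (f i : ℕ)) else 0) =
      if 0 < d ∧ S 1 then Polynomial.X ^ d * compatibleSum d (fun j => S (j + 1)) n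
        else compatibleSum d (fun j => S (j + 1)) (n + 1) := by
    have hcons : (∑ f : Fin (d + 1) → Fin (n + 1), if IsCompatible S f ∧ f 0 = 0 then
        (Polynomial.X : ℤ[X]) ^ (∑ i, (f i : ℕ)) else 0) =
        ∑ g : Fin d → Fin (n + 1),
          if IsCompatible S (Fin.cons 0 g : Fin (d + 1) → Fin (n + 1)) then
          (Polynomial.X : ℤ[X]) ^ (∑ i, (g i : ℕ)) else 0 := by
      symm
      refine Fintype.sum_of_injective
        (fun g => (Fin.cons 0 g : Fin (d + 1) → Fin (n + 1)))
        (Fin.cons_right_injective (α := fun _ => Fin (n + 1)) 0) _ _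
        (fun f hf => ?_) (fun g => ?_)
      · refine if_neg fun h => hf ⟨Fin.tail f, ?_⟩
        simp only [← h.2]
        exact Fin.cons_self_tail f
      · simp [Fin.sum_univ_succ]
    rw [hcons]
    split_ifs with h
    · rw [← sum_compatible_of_pos]
      refine Finset.sum_congr rfl fun g _ => if_congr ?_ rfl rfl
      rw [isCompatible_cons, and_comm, and_congr_right_iff]
      intro hg
      constructor
      · intro h0 i
        have h1 : g ⟨0, h.1⟩ ≤ g i := hg.monotone (Nat.zero_le _)
        exact (lt_of_lt_of_le ((h0 h.1).2 h.2) h1).ne'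
      · exact fun hpos _ => ⟨Fin.zero_le _, fun _ => Fin.pos_iff_ne_zero.2 (hpos _)⟩
    · refine Finset.sum_congr rfl fun g _ => if_congr ?_ rfl rfl
      rw [isCompatible_cons, and_iff_right]
      exact fun hd => ⟨Fin.zero_le _, fun hS => absurd ⟨hd, hS⟩ h⟩
  rw [← sum_compatible_of_pos, ← hzero, ← Finset.sum_add_distrib, compatibleSum]
  refine Finset.sum_congr rfl fun f _ => ?_
  by_cases hf : IsCompatible S f
  · by_cases h0 : f 0 = 0
    · have : ¬ ∀ i, f i ≠ 0 := fun h => h 0 h0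
      simp [hf, h0, this]
    · have : ∀ i, f i ≠ 0 := fun i =>
        (lt_of_lt_of_le (Fin.pos_iff_ne_zero.2 h0) (hf.monotone (Fin.zero_le i))).ne'
      simp [hf, h0, this]
  · simp [hf]

/-- The generating function of `compatibleSum`. The coefficient of `z ^ m` is the sum over the
sequences with entries in `{0, ..., m}`, so that it is `1` for `d = 0` and every `m`. -/
noncomputable def compatibleSeries (d : ℕ) (S : ℕ → Prop) : ℤ[X]⟦X⟧ :=
  PowerSeries.mk fun m => compatibleSum d S (m + 1)

open Classical in
theorem compatibleSeries_succ_mul (d : ℕ) (S : ℕ → Prop) :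
    compatibleSeries (d + 1) S *
        (1 - PowerSeries.C ((Polynomial.X : ℤ[X]) ^ (d + 1)) * PowerSeries.X) =
      (if 0 < d ∧ S 1 then PowerSeries.C ((Polynomial.X : ℤ[X]) ^ d) * PowerSeries.X else 1) *
        compatibleSeries d (fun j => S (j + 1)) := by
  have hX : ∀ (T : ℤ[X]⟦X⟧) (a : ℤ[X]) (m : ℕ),
      PowerSeries.coeff m (PowerSeries.C a * PowerSeries.X * T) =
        if m = 0 then 0 else a * PowerSeries.coeff (m - 1) T := by
    intro T a m
    rw [mul_assoc, PowerSeries.coeff_C_mul]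
    cases m <;> simp [PowerSeries.coeff_succ_X_mul]
  ext1 m
  have hrec := compatibleSum_succ_succ d S m
  rw [mul_comm, sub_mul, one_mul, map_sub, hX]
  have h1 : (if m = 0 then 0 else (Polynomial.X : ℤ[X]) ^ (d + 1) *
      PowerSeries.coeff (m - 1) (compatibleSeries (d + 1) S)) =
      Polynomial.X ^ (d + 1) * compatibleSum (d + 1) S m := by
    cases m <;> simp [compatibleSeries, compatibleSum_succ_zero]
  rw [h1]
  split_ifs at hrec ⊢ with h
  · obtain ⟨e, rfl⟩ := Nat.exists_eq_succ_of_ne_zero h.1.ne'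
    rw [hX]
    cases m <;> simp_all [compatibleSeries, compatibleSum_succ_zero]
  · simp [compatibleSeries, hrec]

open Classical in
theorem compatibleSeries_mul_denominator (d : ℕ) (S : ℕ → Prop) :
    compatibleSeries d S * denominator d =
      PowerSeries.C ((Polynomial.X : ℤ[X]) ^ (∑ j ∈ Finset.Icc 1 (d - 1) with S j, (d - j))) *
        PowerSeries.X ^ (Finset.card {j ∈ Finset.Icc 1 (d - 1) | S j}) := by
  have hIcc : ∀ d : ℕ, Finset.Icc 1 (d - 1) = Finset.Ico (0 + 1) (d - 1 + 1) := by
    intro d; ext; simp only [Finset.mem_Icc, Finset.mem_Ico]; omega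
  simp only [Finset.card_filter, Finset.sum_filter]
  simp only [hIcc, ← Finset.sum_Ico_add', ← Finset.range_eq_Ico]
  induction d generalizing S with
  | zero =>
    have h : compatibleSeries 0 S = PowerSeries.mk 1 := by
      ext1 m
      simp [compatibleSeries, compatibleSum, IsCompatible]
    simpa [denominator, h] using PowerSeries.mk_one_mul_one_sub_eq_one ℤ[X]
  | succ d ih =>
    have hden : denominator (d + 1) = denominator d *
        (1 - PowerSeries.C ((Polynomial.X : ℤ[X]) ^ (d + 1)) * PowerSeries.X) :=
      Finset.prod_range_succ _ _
    rw [hden, mul_left_comm, compatibleSeries_succ_mul, mul_comm (denominator d), mul_assoc, ih]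
    cases d with
    | zero => simp
    | succ e =>
      simp only [Nat.add_sub_cancel, Finset.sum_range_succ' _ e, Nat.reduceSubDiff]
      by_cases h : S 1
      · simp [h, pow_add]
        ring
      · simp [h]

theorem isUnit_denominator (d : ℕ) : IsUnit (denominator d) := by
  simp [denominator, PowerSeries.isUnit_iff_constantCoeff]

/-! ### Ranks and proper colorings -/

variable {d : ℕ} {α : Type*} [LinearOrder α] {G : SimpleGraph (Fin d)} {c : Fin d → α}

/-- The rank increases along the edges of the orientation given by `π`: a longest path ending at
the first vertex can be extended. -/
theorem rank_lt_rank (π : Equiv.Perm (Fin d)) {i j : Fin d} (hij : i < j)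
    (h : G.Adj (π i) (π j)) : rank G π (π i) < rank G π (π j) := by
  obtain ⟨k, hk, p, hp, hlast, hadj⟩ := (isGreatest_rank G π (π i)).1
  have hlast' : p (Fin.last k) = i := π.injective hlast
  have hle : k + 1 + 1 ≤ rank G π (π j) := by
    refine (isGreatest_rank G π (π j)).2
      ⟨k + 1, rfl, (Fin.snoc p j : Fin (k + 1 + 1) → Fin d), ?_, by simp, ?_⟩
    · rw [Fin.strictMono_iff_lt_succ]
      intro a
      induction a using Fin.lastCases with
      | last => simpa [hlast'] using hij
      | cast a =>
        rw [← Fin.castSucc_succ, Fin.snoc_castSucc, Fin.snoc_castSucc]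
        exact hp a.castSucc_lt_succ
    · intro a
      induction a using Fin.lastCases with
      | last => simpa [hlast'] using h
      | cast a =>
        rw [← Fin.castSucc_succ, Fin.snoc_castSucc, Fin.snoc_castSucc]
        exact hadj a
  omega

/-- If `c` is proper and weakly increases along `π`, then the paths in the definition of the rank
are the paths of `G` with strictly increasing colors, a notion independent of `π`. -/
theorem hasPathOfLength_iff (hc : ∀ u v, G.Adj u v → c u ≠ c v) {π : Equiv.Perm (Fin d)}
    (hπ : Monotone (c ∘ π)) (v : Fin d) (r : ℕ) :
    HasPathOfLength G π v r ↔ ∃ k : ℕ, r = k + 1 ∧ ∃ u : Fin (k + 1) → Fin d,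
      u (Fin.last k) = v ∧
        ∀ j : Fin k, G.Adj (u j.castSucc) (u j.succ) ∧ c (u j.castSucc) < c (u j.succ) := by
  constructor
  · rintro ⟨k, rfl, p, hp, hv, h⟩
    exact ⟨k, rfl, π ∘ p, hv, fun j =>
      ⟨h j, lt_of_le_of_ne (hπ (hp j.castSucc_lt_succ).le) (hc _ _ (h j))⟩⟩
  · rintro ⟨k, rfl, u, hv, h⟩
    refine ⟨k, rfl, π.symm ∘ u, Fin.strictMono_iff_lt_succ.2 fun j => ?_, by simpa using hv,
      fun j => by simpa using (h j).1⟩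
    exact hπ.reflect_lt (by simpa using (h j).2)

theorem rank_eq_of_monotone (hc : ∀ u v, G.Adj u v → c u ≠ c v) {π σ : Equiv.Perm (Fin d)}
    (hπ : Monotone (c ∘ π)) (hσ : Monotone (c ∘ σ)) : rank G π = rank G σ := by
  funext v
  simp only [rank, hasPathOfLength_iff hc hπ, hasPathOfLength_iff hc hσ]

theorem isAscentAt_iff {π : Equiv.Perm (Fin d)} {i j : Fin d} (hij : (i : ℕ) + 1 = j) :
    IsAscentAt G π j ↔ rank G π (π i) < rank G π (π j) ∨
      (rank G π (π i) = rank G π (π j) ∧ π i < π j) := by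
  constructor
  · rintro ⟨a, b, ha, hb, h⟩
    obtain rfl : a = i := by ext; omega
    obtain rfl : b = j := by ext; omega
    exact h
  · exact fun h => ⟨i, j, hij, rfl, h⟩

theorem ne_of_isCompatible {π : Equiv.Perm (Fin d)} (h : IsCompatible (IsAscentAt G π) (c ∘ π))
    {u v : Fin d} (huv : G.Adj u v) : c u ≠ c v := by
  wlog hlt : π.symm u < π.symm v generalizing u v
  · refine (this huv.symm (lt_of_le_of_ne (not_lt.1 hlt) fun e => huv.ne ?_)).symm
    exact (π.symm.injective e).symm
  obtain ⟨i, rfl⟩ := π.surjective u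
  obtain ⟨j, rfl⟩ := π.surjective v
  simp only [Equiv.symm_apply_apply] at hlt
  intro he
  -- With equal colors at `i` and `j` there is no ascent between them, so the rank cannot grow.
  have key : ∀ k (hk : k < d), (i : ℕ) ≤ k → k ≤ j → rank G π (π ⟨k, hk⟩) ≤ rank G π (π i) := by
    intro k hk hik
    induction k, hik using Nat.le_induction with
    | base => simp
    | succ k hik ih =>
      intro hkj
      refine le_trans ?_ (ih (by omega) (by omega))
      by_contra! hr
      have hs := (h ⟨k, by omega⟩ ⟨k + 1, hk⟩ rfl).2 ((isAscentAt_iff rfl).2 (Or.inl hr))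
      have h1 : c (π i) ≤ (c ∘ π) ⟨k, by omega⟩ := h.monotone (Fin.mk_le_mk.2 hik)
      have h2 : (c ∘ π) ⟨k + 1, hk⟩ ≤ c (π j) := h.monotone (Fin.mk_le_mk.2 hkj)
      exact absurd he (lt_of_le_of_lt h1 (lt_of_lt_of_le hs h2)).ne
  exact absurd (rank_lt_rank π hlt huv) (not_lt.2 (key j j.2 hlt.le le_rfl))

/-- The sorting key of a vertex for the coloring `c`: color, then decreasing rank, then decreasing
label. The rank is taken with respect to some permutation along which `c` weakly increases; for
proper `c` the choice does not matter, by `rank_eq_of_monotone`. -/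
noncomputable def sortKey {d n : ℕ} (G : SimpleGraph (Fin d)) (c : Fin d → Fin n) (v : Fin d) :
    Fin n ×ₗ (ℕᵒᵈ ×ₗ (Fin d)ᵒᵈ) :=
  toLex (c v, toLex (OrderDual.toDual (rank G (Tuple.sort c) v), OrderDual.toDual v))

theorem sortKey_le_iff {n : ℕ} {c : Fin d → Fin n} {u v : Fin d} :
    sortKey G c u ≤ sortKey G c v ↔ c u ≤ c v ∧
      (rank G (Tuple.sort c) u < rank G (Tuple.sort c) v ∨
        (rank G (Tuple.sort c) u = rank G (Tuple.sort c) v ∧ u < v) → c u < c v) := by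
  simp only [sortKey, Prod.Lex.toLex_le_toLex, OrderDual.toDual_lt_toDual,
    OrderDual.toDual_le_toDual, EmbeddingLike.apply_eq_iff_eq]
  grind

theorem sortKey_injective {n : ℕ} (G : SimpleGraph (Fin d)) (c : Fin d → Fin n) :
    Function.Injective (sortKey G c) := by
  intro u v h
  simpa [sortKey] using congrArg (fun x => (ofLex (ofLex x).2).2) h

theorem isCompatible_iff_monotone_sortKey {n : ℕ} {c : Fin d → Fin n}
    (hc : ∀ u v, G.Adj u v → c u ≠ c v) (π : Equiv.Perm (Fin d)) :
    IsCompatible (IsAscentAt G π) (c ∘ π) ↔ Monotone (sortKey G c ∘ π) := by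
  have step : Monotone (c ∘ π) → ∀ i j : Fin d, (i : ℕ) + 1 = j →
      (sortKey G c (π i) ≤ sortKey G c (π j) ↔
        c (π i) ≤ c (π j) ∧ (IsAscentAt G π j → c (π i) < c (π j))) := by
    intro hm i j hij
    rw [sortKey_le_iff, isAscentAt_iff hij,
      rank_eq_of_monotone hc hm (Tuple.monotone_sort c)]
  constructor
  · intro h
    cases d with
    | zero => exact fun a => a.elim0
    | succ d =>
      refine Fin.monotone_iff_le_succ.2 fun i => ?_
      exact (step h.monotone _ _ (by simp)).2 (h i.castSucc i.succ (by simp))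
  · intro h i j hij
    refine (step (fun a b hab => (sortKey_le_iff.1 (h hab)).1) i j hij).1 (h ?_)
    exact Fin.le_def.2 (by omega)

theorem existsUnique_isCompatible {n : ℕ} {c : Fin d → Fin n}
    (hc : ∀ u v, G.Adj u v → c u ≠ c v) :
    ∃! π : Equiv.Perm (Fin d), IsCompatible (IsAscentAt G π) (c ∘ π) := by
  simp only [isCompatible_iff_monotone_sortKey hc]
  refine ⟨Tuple.sort (sortKey G c), Tuple.monotone_sort _, fun π hπ => ?_⟩
  have h := Tuple.unique_monotone hπ (Tuple.monotone_sort (sortKey G c))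
  exact Equiv.ext fun i => sortKey_injective G c (congrFun h i)

/-! ### The generating function of the chromatic polynomials -/

open Classical in
theorem qChromatic_eq_sum (G : SimpleGraph (Fin d)) (n : ℕ) :
    qChromatic G (fun _ => 1) n = ∑ π : Equiv.Perm (Fin d),
      Polynomial.X ^ d * compatibleSum d (IsAscentAt G π) n := by
  have hcol : qChromatic G (fun _ => 1) n = ∑ c : Fin d → Fin n,
      if ∀ u v, G.Adj u v → c u ≠ c v then
        (Polynomial.X : ℤ[X]) ^ (d + ∑ i, (c i : ℕ)) else 0 := by
    refine Fintype.sum_of_injective (fun c : G.Coloring (Fin n) => (c : Fin d → Fin n))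
      DFunLike.coe_injective _ _ (fun c hc => ?_) (fun c => ?_)
    · exact if_neg fun h => hc ⟨SimpleGraph.Coloring.mk c fun {u v} => h u v, rfl⟩
    · rw [if_pos fun u v huv => c.valid huv]
      simp [Finset.sum_add_distrib, add_comm]
  have hperm : ∀ c : Fin d → Fin n,
      (if ∀ u v, G.Adj u v → c u ≠ c v then
        (Polynomial.X : ℤ[X]) ^ (d + ∑ i, (c i : ℕ)) else 0) =
      ∑ π : Equiv.Perm (Fin d), if IsCompatible (IsAscentAt G π) (c ∘ π) then
        (Polynomial.X : ℤ[X]) ^ (d + ∑ i, (c i : ℕ)) else 0 := by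
    intro c
    split_ifs with hc
    · obtain ⟨π, hπ, huniq⟩ := existsUnique_isCompatible hc
      rw [Finset.sum_eq_single π (fun σ _ hσ => if_neg fun h => hσ (huniq σ h)) (by simp),
        if_pos hπ]
    · exact (Finset.sum_eq_zero fun π _ =>
        if_neg fun h => hc fun u v huv => ne_of_isCompatible h huv).symm
  rw [hcol, Finset.sum_congr rfl fun c _ => hperm c, Finset.sum_comm]
  refine Finset.sum_congr rfl fun π _ => ?_
  rw [compatibleSum, Finset.mul_sum]
  refine Fintype.sum_equiv (π.symm.arrowCongr (Equiv.refl _)) _ _ fun c => ?_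
  have hc : π.symm.arrowCongr (Equiv.refl _) c = c ∘ π := rfl
  have hs : ∑ i, ((c ∘ π) i : ℕ) = ∑ i, (c i : ℕ) := Equiv.sum_comp π fun i => (c i : ℕ)
  rw [hc, hs, mul_ite, mul_zero, pow_add]

theorem qChromaticSeries_eq_sum (hd : 0 < d) (G : SimpleGraph (Fin d)) :
    qChromaticSeries G (fun _ => 1) = ∑ π : Equiv.Perm (Fin d),
      PowerSeries.C ((Polynomial.X : ℤ[X]) ^ d) *
        (PowerSeries.X * compatibleSeries d (IsAscentAt G π)) := by
  obtain ⟨e, rfl⟩ := Nat.exists_eq_succ_of_ne_zero hd.ne'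
  ext1 n
  simp only [qChromaticSeries, PowerSeries.coeff_mk, qChromatic_eq_sum, map_sum,
    PowerSeries.coeff_C_mul]
  refine Finset.sum_congr rfl fun π _ => ?_
  cases n <;> simp [compatibleSum_succ_zero, compatibleSeries, PowerSeries.coeff_succ_X_mul]

theorem qChromaticSeries_mul_denominator (hd : 0 < d) (G : SimpleGraph (Fin d)) :
    qChromaticSeries G (fun _ => 1) * denominator d = numerator G := by
  rw [qChromaticSeries_eq_sum hd, Finset.sum_mul, numerator]
  refine Finset.sum_congr rfl fun π _ => ?_
  rw [mul_assoc, mul_assoc, compatibleSeries_mul_denominator, ascents, pow_add, pow_succ, map_mul]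
  ring

end QChromatic

theorem theorem4p1 (d : ℕ) (hd : 0 < d) (G : SimpleGraph (Fin d)) :
    IsUnit (QChromatic.denominator d) ∧
      QChromatic.qChromaticSeries G (fun _ => 1) =
        QChromatic.numerator G * Ring.inverse (QChromatic.denominator d) := by
  have hu := QChromatic.isUnit_denominator d
  refine ⟨hu, ?_⟩
  rw [← QChromatic.qChromaticSeries_mul_denominator hd G, mul_assoc,
    Ring.mul_inverse_cancel _ hu, mul_one]
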